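/- Let $k$ be an algebraically closed field of characteristic $0$, let $f,g\in k[x,y]$ be non-constant polynomials defining plane curves $C_f,C_g$, and let $P=(p_1,p_2)\in\mathbb{A}^2(k)$. Notation. The multiplicity $m_P(f)$ is the degree of the lowest nonzero homogeneous term of $f(x+p_1,y+p_2)$. The blowup of $\mathbb{A}^2$ at $P$ is the surface $\{(x-p_1)t_1=(y-p_2)t_0\}\subset\mathbb{A}^2\times\mathbb{P}^1$, with exceptional line $E=\{P\}\times\mathbb{P}^1$. In its affine charts $t_0\neq0$ (coordinates $x-p_1$ and $t_1/t_0$) and $t_1\ne0$ (coordinates $t_0/t_1$ and $y-p_2$), both isomorphic to $\mathbb{A}^2$, the strict transform of $C_f$ is defined by the polynomial $f'$ obtained from the pullback of $f$ by dividing by $e^{m_P(f)}$, where $e$ (equal to $x-p_1$, respectively $y-p_2$) is the coordinate defining $E$. The first order infinitely near points of $C_f$ at $P$ are the points of $E$ lying on the strict transform. For $r\ge 2$, the infinitely near points of $C_f$ at $P$ of order $r$ are the infinitely near points of order $r-1$, at $Q$, of the strict transform of $C_f$, where $Q$ runs through the first order infinitely near points of $C_f$ at $P$; such a point is identified with the sequence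 of the $r$ successive points that lead to it. The number $\mathcal{B}_P(f,g)$ is defined recursively by $$\mathcal{B}_P(f,g)=\begin{cases}\infty,&\text{if } C_f \text{ and } C_g \text{ share an irreducible component passing through } P,\\ 0,&\text{if } f(P)\neq0 \text{ or } g(P)\ne0,\\ m_P(f)\,m_P(g)+\sum_Q\mathcal{B}_Q(f',g'),&\text{otherwise,}\end{cases}$$ where $Q$ runs through the first order infinitely near points at $P$ common to $C_f$ and $C_g$, and $f',g'$ define the strict transforms in an affine chart containing $Q$. Claim. If $C_f$ and $C_g$ have no common irreducible component passing through $P$, then the recursive computation of $\mathcal{B}_P(f,g)$ terminates after finitely many steps, and there exists an integer $r\ge1$ such that $C_f$ and $C_g$ have no infinitely near point at $P$ of order $r$ in common. -/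

import Mathlib

open MvPolynomial

noncomputable section

namespace PlaneBlowup

variable {k : Type*} [Field k]

/-- The polynomial `f(x + p₁, y + p₂)`: the Taylor expansion of `f` at `P = (p₁, p₂)`, written in
the coordinates centred at `P`. -/
def taylorAt (f : MvPolynomial (Fin 2) k) (P : Fin 2 → k) : MvPolynomial (Fin 2) k :=
  aeval (fun i => X i + C (P i)) f

/-- The multiplicity `m_P(f)`: the degree of the lowest nonzero homogeneous term of the Taylor
expansion of `f` at `P`. -/
def multAt (f : MvPolynomial (Fin 2) k) (P : Fin 2 → k) : ℕ :=
  sInf {n : ℕ | homogeneousComponent n (taylorAt f P) ≠ 0}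

/-- The curves of `f` and `g` have a common (irreducible) component passing through `P`. -/
def ShareComponentAt (f g : MvPolynomial (Fin 2) k) (P : Fin 2 → k) : Prop :=
  ∃ h : MvPolynomial (Fin 2) k, Irreducible h ∧ h ∣ f ∧ h ∣ g ∧ eval P h = 0

/-! The blowup of the plane at `P` is the surface `(x - p₁) t₁ = (y - p₂) t₀` in `𝔸² × ℙ¹`.
Its exceptional line is `{P} × ℙ¹`. We write `ℙ¹(k)` as `OnePoint k`: the element `c : k` is the
point `(1 : c)` and `∞` is the point `(0 : 1)`. Around `(1 : c)` we use the chart `t₀ ≠ 0` with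
coordinates `(x - p₁, t₁ / t₀)`, and around `(0 : 1)` the chart `t₁ ≠ 0` with coordinates
`(t₀ / t₁, y - p₂)`. Both charts are isomorphic to `𝔸²`. -/

/-- The index of the coordinate that defines the exceptional line in the chart used around `d`. -/
def excCoord : OnePoint k → Fin 2
  | OnePoint.some _ => 0
  | OnePoint.infty => 1

/-- The blowup morphism in the chart used around `d`, for blowing up the origin:
`(x, z) ↦ (x, x z)` in the chart `t₀ ≠ 0` and `(w, y) ↦ (w y, y)` in the chart `t₁ ≠ 0`. -/
def chartMap : OnePoint k → Fin 2 → MvPolynomial (Fin 2) k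
  | OnePoint.some _ => ![X 0, X 0 * X 1]
  | OnePoint.infty => ![X 0 * X 1, X 1]

/-- The point `d` of the exceptional line, in the coordinates of the chart used around it. -/
def chartPoint : OnePoint k → Fin 2 → k
  | OnePoint.some c => ![0, c]
  | OnePoint.infty => ![0, 0]

/-- The pullback `f ∘ π` of `f` under the blowup `π` at `P`, in the chart used around `d`. -/
def totalTransform (f : MvPolynomial (Fin 2) k) (P : Fin 2 → k) (d : OnePoint k) :
    MvPolynomial (Fin 2) k :=
  aeval (fun i => chartMap d i + C (P i)) f

/-- The polynomial `f'` of the strict transform of `C_f` under the blowup at `P`, in the chart used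
around `d`: the pullback of `f` with the factor `e ^ m_P(f)` removed, where `e` is the coordinate
that defines the exceptional line. -/
def strictTransform (f : MvPolynomial (Fin 2) k) (P : Fin 2 → k) (d : OnePoint k) :
    MvPolynomial (Fin 2) k :=
  (totalTransform f P d).divMonomial (Finsupp.single (excCoord d) (multAt f P))

/-- The first order infinitely near points of `C_f` at `P`: the points of the exceptional line of
the blowup at `P` that lie on the strict transform of `C_f`. -/
def firstNearPoints (f : MvPolynomial (Fin 2) k) (P : Fin 2 → k) : Set (OnePoint k) :=
  {d | eval (chartPoint d) (strictTransform f P d) = 0}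

/-- `IsNearPath f P [d₁, …, d_r]` says that `d₁` is a first order infinitely near point of `C_f`
at `P`, that `d₂` is a first order infinitely near point at `d₁` of the strict transform of `C_f`,
and so on. The charts and the centres of the successive blowups depend only on `P` and on the list,
not on `f`, so that equal lists describe equal points for all curves. -/
def IsNearPath : MvPolynomial (Fin 2) k → (Fin 2 → k) → List (OnePoint k) → Prop
  | _, _, [] => True
  | f, P, d :: l => d ∈ firstNearPoints f P ∧ IsNearPath (strictTransform f P d) (chartPoint d) l

/-- The infinitely near points of order `r` of `C_f` at `P`, for `1 ≤ r`. -/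
def nearPoints (f : MvPolynomial (Fin 2) k) (P : Fin 2 → k) (r : ℕ) : Set (List (OnePoint k)) :=
  {l | l.length = r ∧ IsNearPath f P l}

/-- `ComputesB f g P b n`: the recursive computation of the number `𝓑_P(f, g)` terminates with
the result `b`, after evaluating the recursive definition `n` times in total. The definition is:
* `𝓑_P(f, g) = ∞` if `C_f` and `C_g` share a component passing through `P`;
* `𝓑_P(f, g) = 0` if `P` does not lie on both curves;
* otherwise `𝓑_P(f, g) = m_P(f) m_P(g) + ∑_Q 𝓑_Q(f', g')`, where `Q` runs through the first order
  infinitely near points at `P` common to `C_f` and `C_g`. -/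
inductive ComputesB : MvPolynomial (Fin 2) k → MvPolynomial (Fin 2) k → (Fin 2 → k) → ℕ∞ → ℕ → Prop
  | share {f g : MvPolynomial (Fin 2) k} {P : Fin 2 → k} (h : ShareComponentAt f g P) :
      ComputesB f g P ⊤ 1
  | off {f g : MvPolynomial (Fin 2) k} {P : Fin 2 → k} (h : ¬ (eval P f = 0 ∧ eval P g = 0)) :
      ComputesB f g P 0 1
  | blowup {f g : MvPolynomial (Fin 2) k} {P : Fin 2 → k}
      (hs : ¬ ShareComponentAt f g P) (hf : eval P f = 0) (hg : eval P g = 0)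
      (S : Finset (OnePoint k)) (hS : (S : Set (OnePoint k)) = firstNearPoints f P ∩ firstNearPoints g P)
      (b : OnePoint k → ℕ∞) (n : OnePoint k → ℕ)
      (hb : ∀ d ∈ S,
        ComputesB (strictTransform f P d) (strictTransform g P d) (chartPoint d) (b d) (n d)) :
      ComputesB f g P ((multAt f P : ℕ∞) * (multAt g P : ℕ∞) + ∑ d ∈ S, b d) (1 + ∑ d ∈ S, n d)

end PlaneBlowup

end

noncomputable section

namespace PlaneBlowup

/-! The local intersection number at `P` decreases under blowing up. It is replaced by a uniform
bound `D` on the colengths of `(f, g) + 𝔪 ^ N` over all `N` (`ColengthLE`), which avoids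
localization. If no common component passes through `P`, such a `D` exists (`exists_colengthLE`). At
a common first order point the strict transforms satisfy the bound `D - 1` (`ColengthLE.blowup`).
There are finitely many such points, so induction on `D` gives both claims
(`ColengthLE.terminates`). For the drop, let `m ≤ n` be the multiplicities, `J = (f', g') + 𝔪_d ^ N`
and `U = x ^ n J + (f')`. The pullback carries `(f, g) + 𝔪 ^ (n + N)` into `U`. Modulo `U`, every
multiple of `x ^ (m - 1)` is a pullback, and the `h` with `x ^ (m - 1) h ∈ U` lie in a proper
subspace of `J`. Comparing dimensions gives a drop of at least one, so Noether's formula is not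
needed. -/

theorem length_quotient_add_one_le_of_lt {k V : Type*} [Field k] [AddCommGroup V] [Module k V]
    {K J : Submodule k V} (h : K < J) :
    Module.length k (V ⧸ J) + 1 ≤ Module.length k (V ⧸ K) := by
  rw [Module.length_quotient, Module.length_quotient]
  exact Order.coheight_add_one_le h

/-! ### Colength in an abstract blowup chart -/

section Chart

variable {k R S : Type*} [Field k] [CommRing R] [Algebra k R] [CommRing S]
  [Algebra k S] {φ : R →ₐ[k] S} {χ : S →ₐ[k] Polynomial k} {x z : S}

/-- Multiples of `x ^ (m - 1)` descend along the blowup, modulo the strict transform and high powers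
of the exceptional coordinate `x`. Here `χ` is restriction to the exceptional line. -/
theorem pow_mul_mem_range_sup (hx : x ∈ φ.range) (hxz : x * z ∈ φ.range)
    (hχ : ∀ h, x ∣ h - Polynomial.aeval z (χ h)) {f' : S} {m : ℕ} (hF : χ f' ≠ 0)
    (hm : (χ f').natDegree ≤ m) (U : Ideal S) (hf' : f' ∈ U) (N : ℕ) (hN : x ^ N ∈ U)
    (hm1 : 1 ≤ m) (h : S) :
    ∃ a : R, x ^ (m - 1) * h - φ a ∈ U := by
  -- Downward induction on the exponent `i`, starting where `x ^ i ∈ U`; `j` bounds the steps left.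
  suffices H : ∀ j i, m - 1 ≤ i → N ≤ i + j → ∀ h : S, ∃ a : R, x ^ i * h - φ a ∈ U from
    H N (m - 1) le_rfl (by omega) h
  intro j
  induction j with
  | zero =>
    intro i _ hi h
    refine ⟨0, ?_⟩
    rw [map_zero, sub_zero]
    exact U.mul_mem_right _ (U.mem_of_dvd (pow_dvd_pow x (by omega)) hN)
  | succ j ih =>
    intro i hmi hi h
    obtain ⟨u, hu⟩ := hχ h
    obtain ⟨v, hv⟩ := hχ f'
    set G := χ h
    set F := χ f'
    -- Divide `G` by `F` on the exceptional line: modulo `f'`, `h` becomes the remainder plus `x`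
    -- times this element.
    obtain ⟨a, ha⟩ := ih (i + 1) (by omega) (by omega) (u - Polynomial.aeval z (G / F) * v)
    -- The remainder has degree at most `m - 1 ≤ i`, so each `z ^ t` can be paired with `x ^ t`.
    have hr : x ^ i * Polynomial.aeval z (G % F) ∈ φ.range := by
      rw [Polynomial.aeval_eq_sum_range, Finset.mul_sum]
      refine sum_mem fun t ht => ?_
      have hti : t ≤ i := by
        by_cases h0 : F.natDegree = 0
        · have : G % F = 0 := by
            rw [Polynomial.eq_C_of_natDegree_eq_zero h0] at hF ⊢
            exact (EuclideanDomain.mod_eq_zero).2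
              ((Polynomial.isUnit_C.2 (by simpa using hF)).dvd)
          simp [this] at ht
          omega
        · have := Polynomial.natDegree_mod_lt G h0
          have := Finset.mem_range.1 ht
          omega
      rw [mul_smul_comm]
      refine Subalgebra.smul_mem _ ?_ _
      have : x ^ i * z ^ t = x ^ (i - t) * (x * z) ^ t := by
        rw [mul_pow, ← mul_assoc, ← pow_add, Nat.sub_add_cancel hti]
      rw [this]
      exact mul_mem (pow_mem hx _) (pow_mem hxz _)
    obtain ⟨b, hb⟩ := hr
    refine ⟨a + b, ?_⟩
    have hG : Polynomial.aeval z G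
        = Polynomial.aeval z F * Polynomial.aeval z (G / F) + Polynomial.aeval z (G % F) := by
      rw [← map_mul, ← map_add, EuclideanDomain.div_add_mod]
    have key : x ^ i * h - φ (a + b) =
        (x ^ (i + 1) * (u - Polynomial.aeval z (G / F) * v) - φ a) +
          x ^ i * Polynomial.aeval z (G / F) * f' := by
      have hb' : φ b = x ^ i * Polynomial.aeval z (G % F) := hb
      rw [map_add, hb', eq_add_of_sub_eq hu, hG]
      linear_combination (- x ^ i * Polynomial.aeval z (G / F)) * hv
    rw [key]
    exact U.add_mem ha (U.mul_mem_left _ hf')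

/-- The colength drops strictly under blowing up. -/
theorem length_quotient_blowup_add_one_le [IsDomain S] (hx : x ∈ φ.range) (hxz : x * z ∈ φ.range)
    (hχ : ∀ h, x ∣ h - Polynomial.aeval z (χ h)) (hχx : χ x = 0) (hxp : Prime x)
    {f' g' : S} {m n N : ℕ} (hF : χ f' ≠ 0) (hm : (χ f').natDegree ≤ m) (hm1 : 1 ≤ m) (hmn : m ≤ n)
    (ev : S →ₐ[k] k) (hevx : ev x = 0) (hevf : ev f' = 0)
    {J : Ideal S} (hfJ : f' ∈ J) (hgJ : g' ∈ J) (hN : x ^ N ∈ J)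
    {M : Ideal R} (hM : ∀ a ∈ M, x ∣ φ a) {f g : R}
    (hf : φ f = x ^ m * f') (hg : φ g = x ^ n * g') :
    Module.length k (S ⧸ J.restrictScalars k) + 1 ≤
      Module.length k (R ⧸ (Ideal.span {f, g} ⊔ M ^ (n + N)).restrictScalars k) := by
  set U : Ideal S := Ideal.span {x ^ n} * J ⊔ Ideal.span {f'} with hU
  have hxf : ¬ x ∣ f' := by
    rintro ⟨c, rfl⟩
    exact hF (by rw [map_mul, hχx, zero_mul])
  have hmemU : ∀ s, s ∈ U ↔ ∃ j ∈ J, ∃ b, x ^ n * j + b * f' = s := by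
    intro s
    rw [hU, Submodule.mem_sup]
    constructor
    · rintro ⟨y, hy, w, hw, rfl⟩
      obtain ⟨j, hj, rfl⟩ := Ideal.mem_span_singleton_mul.1 hy
      obtain ⟨b, rfl⟩ := Ideal.mem_span_singleton'.1 hw
      exact ⟨j, hj, b, rfl⟩
    · rintro ⟨j, hj, b, rfl⟩
      exact ⟨_, Ideal.mem_span_singleton_mul.2 ⟨j, hj, rfl⟩, _,
        Ideal.mem_span_singleton'.2 ⟨b, rfl⟩, rfl⟩
  have hfU : f' ∈ U := (hmemU _).2 ⟨0, J.zero_mem, 1, by ring⟩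
  have hxU : x ^ (n + N) ∈ U := (hmemU _).2 ⟨x ^ N, hN, 0, by ring⟩
  have hIU : Ideal.span {f, g} ⊔ M ^ (n + N) ≤ U.comap φ := by
    refine sup_le (Ideal.span_le.2 ?_) ?_
    · rintro a (rfl | rfl)
      · exact Ideal.mem_comap.2 (hf ▸ U.mul_mem_left _ hfU)
      · exact Ideal.mem_comap.2 (hg ▸ (hmemU _).2 ⟨g', hgJ, 0, by ring⟩)
    · have h1 : M ≤ (Ideal.span {x}).comap φ := fun a ha =>
        Ideal.mem_comap.2 (Ideal.mem_span_singleton.2 (hM a ha))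
      refine (Ideal.pow_right_mono h1 _).trans ((Ideal.le_comap_pow _ _).trans
        (Ideal.comap_mono ?_))
      rw [Ideal.span_singleton_pow, Ideal.span_singleton_le_iff_mem]
      exact hxU
  let UK : Submodule k S := U.restrictScalars k
  let α : R →ₗ[k] S ⧸ UK := UK.mkQ ∘ₗ φ.toLinearMap
  let β : S →ₗ[k] S ⧸ UK := UK.mkQ ∘ₗ LinearMap.mulLeft k (x ^ (m - 1))
  have hβα : LinearMap.range β ≤ LinearMap.range α := by
    rintro _ ⟨h, rfl⟩
    obtain ⟨a, ha⟩ := pow_mul_mem_range_sup hx hxz hχ hF hm U hfU (n + N) hxU hm1 h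
    exact ⟨a, ((Submodule.Quotient.eq UK).2 ha).symm⟩
  -- In `x ^ (m - 1) h = x ^ n j + b f'`, the prime `x` does not divide `f'`, so `x ^ (m - 1)`
  -- divides `b` and cancels.
  have hker : LinearMap.ker β ≤ (Ideal.span {x ^ (n - (m - 1))} * J ⊔ Ideal.span {f'} :
      Ideal S).restrictScalars k := by
    intro h hh
    have hh' : x ^ (m - 1) * h ∈ U := (Submodule.Quotient.mk_eq_zero UK).1 hh
    obtain ⟨j, hj, b, hb⟩ := (hmemU _).1 hh'
    have hsplit : x ^ n = x ^ (m - 1) * x ^ (n - (m - 1)) := by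
      rw [← pow_add]; congr 1; omega
    have hdvd : x ^ (m - 1) ∣ b * f' :=
      ⟨h - x ^ (n - (m - 1)) * j, by rw [mul_sub, ← hb, hsplit]; ring⟩
    obtain ⟨c, rfl⟩ := hxp.pow_dvd_of_dvd_mul_right _ hxf hdvd
    have : h = x ^ (n - (m - 1)) * j + c * f' := by
      refine mul_left_cancel₀ (pow_ne_zero (m - 1) hxp.ne_zero) ?_
      rw [← hb, hsplit]; ring
    rw [this]
    exact Ideal.add_mem _ (Ideal.mem_sup_left (Ideal.mem_span_singleton_mul.2 ⟨j, hj, rfl⟩))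
      (Ideal.mem_sup_right (Ideal.mem_span_singleton'.2 ⟨c, rfl⟩))
  have hle : (Ideal.span {x ^ (n - (m - 1))} * J ⊔ Ideal.span {f'} : Ideal S) ≤ J :=
    sup_le Ideal.mul_le_right (by rwa [Ideal.span_singleton_le_iff_mem])
  -- Nakayama by hand: since `m ≤ n` the exponent is positive, and iterating would put `x ^ N` in
  -- `(x ^ (N + 1), f')`. Cancelling `x ^ N` gives `1 ∈ (x, f')`, but both vanish under `ev`.
  have hne : ¬ J ≤ Ideal.span {x ^ (n - (m - 1))} * J ⊔ Ideal.span {f'} := by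
    intro hJ
    have hiter : ∀ t, J ≤ Ideal.span {x ^ t} ⊔ Ideal.span {f'} := by
      intro t
      induction t with
      | zero => simp
      | succ t ih =>
        refine hJ.trans (sup_le ?_ le_sup_right)
        refine (Ideal.mul_mono (Ideal.span_singleton_le_span_singleton.2
          (dvd_pow_self x (by omega : n - (m - 1) ≠ 0))) ih).trans ?_
        rw [Ideal.mul_sup, Ideal.span_singleton_mul_span_singleton, ← pow_succ']
        exact sup_le_sup_left Ideal.mul_le_right _
    obtain ⟨y, hy, w, hw, hyw⟩ := Submodule.mem_sup.1 (hiter (N + 1) hN)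
    obtain ⟨a, rfl⟩ := Ideal.mem_span_singleton'.1 hy
    obtain ⟨b, rfl⟩ := Ideal.mem_span_singleton'.1 hw
    have hdvd : x ^ N ∣ b * f' := ⟨1 - a * x, by linear_combination hyw⟩
    obtain ⟨c, rfl⟩ := hxp.pow_dvd_of_dvd_mul_right _ hxf hdvd
    have h1 : a * x + c * f' = 1 := by
      refine mul_left_cancel₀ (pow_ne_zero N hxp.ne_zero) ?_
      linear_combination hyw
    have := congrArg ev h1
    simp [hevx, hevf] at this
  have hlt : LinearMap.ker β < J.restrictScalars k :=
    ⟨hker.trans hle, fun h => hne (fun s hs => hker (h hs))⟩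
  have hIα : (Ideal.span {f, g} ⊔ M ^ (n + N)).restrictScalars k ≤ LinearMap.ker α := by
    intro a ha
    exact (Submodule.Quotient.mk_eq_zero UK).2 (hIU ha)
  calc Module.length k (S ⧸ J.restrictScalars k) + 1
      ≤ Module.length k (S ⧸ LinearMap.ker β) := length_quotient_add_one_le_of_lt hlt
    _ = Module.length k (LinearMap.range β) := β.quotKerEquivRange.length_eq
    _ ≤ Module.length k (LinearMap.range α) :=
        Module.length_le_of_injective _ (Submodule.inclusion_injective hβα)
    _ = Module.length k (R ⧸ LinearMap.ker α) := α.quotKerEquivRange.length_eq.symm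
    _ ≤ _ := Module.length_le_of_surjective _ (Submodule.factor_surjective hIα)

end Chart

variable {k : Type*} [Field k]

/-! ### The exceptional line and homogeneous forms -/

theorem fin_two_eq_or (e i : Fin 2) : i = e ∨ i = e + 1 := by
  revert e i; decide

theorem fin_two_degree (e : Fin 2) (s : Fin 2 →₀ ℕ) : s.degree = s e + s (e + 1) := by
  rw [Finsupp.degree_eq_sum, Fin.sum_univ_two]
  fin_cases e
  · rfl
  · exact add_comm _ _

/-- Restriction to the line `X e = 0`, as a polynomial in the other coordinate. -/
def restrictLine (e : Fin 2) : MvPolynomial (Fin 2) k →ₐ[k] Polynomial k :=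
  aeval (fun i => if i = e then 0 else Polynomial.X)

/-- Dehomogenization: set the coordinate `X e` equal to `1`. -/
def dehomogenize (e : Fin 2) : MvPolynomial (Fin 2) k →ₐ[k] Polynomial k :=
  aeval (fun i => if i = e then 1 else Polynomial.X)

theorem restrictLine_X_self (e : Fin 2) : restrictLine (k := k) e (X e) = 0 := by
  simp [restrictLine]

theorem restrictLine_aeval (e : Fin 2) (F : Polynomial k) :
    restrictLine e (Polynomial.aeval (X (e + 1) : MvPolynomial (Fin 2) k) F) = F := by
  rw [← Polynomial.aeval_algHom_apply]
  simp [restrictLine]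

theorem X_dvd_sub_restrictLine (e : Fin 2) (h : MvPolynomial (Fin 2) k) :
    X e ∣ h - Polynomial.aeval (X (e + 1) : MvPolynomial (Fin 2) k) (restrictLine e h) := by
  rw [← Ideal.mem_span_singleton, ← Ideal.Quotient.eq]
  let I : Ideal (MvPolynomial (Fin 2) k) := Ideal.span {X e}
  let q := Ideal.Quotient.mkₐ k I
  have : q = (q.comp (Polynomial.aeval (X (e + 1) : MvPolynomial (Fin 2) k))).comp
      (restrictLine e) := by
    refine MvPolynomial.algHom_ext fun i => ?_
    rcases fin_two_eq_or e i with rfl | rfl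
    · simp only [AlgHom.comp_apply, restrictLine_X_self, map_zero]
      exact Ideal.Quotient.eq_zero_iff_mem.2 (Ideal.mem_span_singleton_self _)
    · simp [restrictLine]
  exact DFunLike.congr_fun this h

/-- This uniform formula, with `e + 1` as the other index in `Fin 2`, lets both charts be treated at
once. -/
theorem chartMap_apply (d : OnePoint k) (i : Fin 2) :
    chartMap d i = X (excCoord d) * (if i = excCoord d then 1 else X i) := by
  rcases d with _ | c
  · fin_cases i
    · simp [chartMap, excCoord, mul_comm]
    · simp [chartMap, excCoord]
  · fin_cases i
    · simp [chartMap, excCoord]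
    · simp [chartMap, excCoord]

theorem chartPoint_excCoord (d : OnePoint k) : chartPoint d (excCoord d) = 0 := by
  rcases d with _ | c
  · simp [chartPoint, excCoord]
  · simp [chartPoint, excCoord]

theorem eval_chartPoint (d : OnePoint k) (h : MvPolynomial (Fin 2) k) :
    eval (chartPoint d) h =
      (restrictLine (excCoord d) h).eval (chartPoint d (excCoord d + 1)) := by
  have : (aeval (chartPoint d) : MvPolynomial (Fin 2) k →ₐ[k] k) =
      (Polynomial.aeval (chartPoint d (excCoord d + 1))).comp (restrictLine (excCoord d)) := by
    refine MvPolynomial.algHom_ext fun i => ?_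
    rcases fin_two_eq_or (excCoord d) i with rfl | rfl
    · simp [restrictLine, chartPoint_excCoord]
    · simp [restrictLine]
  simpa [aeval_eq_eval] using DFunLike.congr_fun this h

theorem degree_eq_of_mem_support {T : MvPolynomial (Fin 2) k} {m : ℕ}
    (hT : T.IsHomogeneous m) {s : Fin 2 →₀ ℕ} (hs : s ∈ T.support) : s.degree = m :=
  by_contra fun h => mem_support_iff.1 hs (hT.coeff_eq_zero h)

/-- In fixed degree, one exponent determines the monomial, so no terms merge. -/
theorem coeff_dehomogenize {e : Fin 2} {T : MvPolynomial (Fin 2) k} {m : ℕ}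
    (hT : T.IsHomogeneous m) {s : Fin 2 →₀ ℕ} (hs : s ∈ T.support) :
    (dehomogenize e T).coeff (s (e + 1)) = T.coeff s := by
  rw [dehomogenize, aeval_def, eval₂_eq', Polynomial.finsetSum_coeff, Finset.sum_eq_single s]
  · simp only [Fin.prod_univ_two]
    fin_cases e <;> simp
  · intro t ht hts
    have hne : t (e + 1) ≠ s (e + 1) := by
      intro h
      have h1 := degree_eq_of_mem_support hT ht
      have h2 := degree_eq_of_mem_support hT hs
      rw [fin_two_degree e] at h1 h2
      refine hts (Finsupp.ext fun i => ?_)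
      rcases fin_two_eq_or e i with rfl | rfl <;> omega
    simp only [Fin.prod_univ_two]
    fin_cases e <;> simp [Polynomial.coeff_X_pow] <;> exact fun h => absurd h.symm hne
  · intro h
    exact absurd hs h

theorem dehomogenize_ne_zero {e : Fin 2} {T : MvPolynomial (Fin 2) k} {m : ℕ}
    (hT : T.IsHomogeneous m) (h0 : T ≠ 0) : dehomogenize e T ≠ 0 := by
  obtain ⟨s, hs⟩ := (support_nonempty.2 h0)
  intro h
  have := coeff_dehomogenize (e := e) hT hs
  rw [h, Polynomial.coeff_zero] at this
  exact (mem_support_iff.1 hs) this.symm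

theorem natDegree_dehomogenize_le {e : Fin 2} {T : MvPolynomial (Fin 2) k} {m : ℕ}
    (hT : T.IsHomogeneous m) : (dehomogenize e T).natDegree ≤ m := by
  rw [dehomogenize, aeval_def, eval₂_eq']
  refine Polynomial.natDegree_sum_le_of_forall_le _ _ fun s hs => ?_
  have h2 := degree_eq_of_mem_support hT hs
  rw [fin_two_degree e] at h2
  refine (Polynomial.natDegree_C_mul_le _ _).trans ?_
  simp only [Fin.prod_univ_two]
  fin_cases e
  · simp at h2 ⊢; omega
  · simp at h2 ⊢; omega

theorem aeval_mul_of_isHomogeneous {A : Type*} [CommRing A] [Algebra k A] (x : A) (v : Fin 2 → A)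
    {T : MvPolynomial (Fin 2) k} {m : ℕ} (hT : T.IsHomogeneous m) :
    aeval (fun i => x * v i) T = x ^ m * aeval v T := by
  simp only [aeval_def, eval₂_eq', Finset.mul_sum]
  refine Finset.sum_congr rfl fun s hs => ?_
  have h2 := degree_eq_of_mem_support hT hs
  rw [fin_two_degree 0] at h2
  simp only [Fin.prod_univ_two, mul_pow]
  rw [← h2, pow_add, zero_add]
  ring

theorem pow_dvd_aeval_mul {A : Type*} [CommRing A] [Algebra k A] (x : A) (v : Fin 2 → A)
    {T : MvPolynomial (Fin 2) k} {a : ℕ} (hT : ∀ s ∈ T.support, a ≤ s.degree) :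
    x ^ a ∣ aeval (fun i => x * v i) T := by
  simp only [aeval_def, eval₂_eq']
  refine Finset.dvd_sum fun s hs => Dvd.dvd.mul_left ?_ _
  have h2 := hT s hs
  rw [fin_two_degree 0] at h2
  refine (pow_dvd_pow x h2).trans ?_
  simp only [Fin.prod_univ_two, mul_pow]
  exact ⟨v 0 ^ s 0 * v 1 ^ s 1, by rw [pow_add, zero_add]; ring⟩

/-! ### Multiplicities, tangent cones and strict transforms -/

theorem eval_eq_coeff_taylorAt (f : MvPolynomial (Fin 2) k) (P : Fin 2 → k) :
    coeff 0 (taylorAt f P) = eval P f := by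
  have : (aeval (fun _ : Fin 2 => (0 : k))).comp
      (aeval (fun i => X i + C (P i)) : MvPolynomial (Fin 2) k →ₐ[k] MvPolynomial (Fin 2) k)
      = aeval P := by
    refine MvPolynomial.algHom_ext fun i => ?_
    simp [aeval_eq_eval]
  have h := DFunLike.congr_fun this f
  rw [AlgHom.comp_apply, aeval_eq_eval, aeval_eq_eval] at h
  rw [← constantCoeff_eq, ← eval_zero']
  exact h

theorem taylorAt_ne_zero {f : MvPolynomial (Fin 2) k} (hf : f ≠ 0) (P : Fin 2 → k) :
    taylorAt f P ≠ 0 := by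
  have : (aeval (fun i => X i - C (P i))).comp
      (aeval (fun i => X i + C (P i)) : MvPolynomial (Fin 2) k →ₐ[k] MvPolynomial (Fin 2) k)
      = AlgHom.id k _ := by
    refine MvPolynomial.algHom_ext fun i => ?_
    simp [← algebraMap_eq]
  intro h
  have h1 := DFunLike.congr_fun this f
  rw [AlgHom.comp_apply] at h1
  rw [taylorAt] at h
  rw [h, map_zero] at h1
  exact hf h1.symm

theorem homogeneousComponent_multAt_ne_zero {f : MvPolynomial (Fin 2) k} (hf : f ≠ 0)
    (P : Fin 2 → k) : homogeneousComponent (multAt f P) (taylorAt f P) ≠ 0 := by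
  refine Nat.sInf_mem (s := {n : ℕ | homogeneousComponent n (taylorAt f P) ≠ 0}) ?_
  by_contra h
  rw [Set.not_nonempty_iff_eq_empty, Set.eq_empty_iff_forall_notMem] at h
  refine taylorAt_ne_zero hf P ?_
  rw [← sum_homogeneousComponent (taylorAt f P)]
  exact Finset.sum_eq_zero fun n _ => not_not.1 (h n)

theorem multAt_eq_zero {f : MvPolynomial (Fin 2) k} {P : Fin 2 → k} (h : eval P f ≠ 0) :
    multAt f P = 0 := by
  refine Nat.sInf_eq_zero.2 (Or.inl ?_)
  rw [Set.mem_ofPred_eq, homogeneousComponent_zero, eval_eq_coeff_taylorAt]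
  simpa using h

theorem one_le_multAt {f : MvPolynomial (Fin 2) k} (hf : f ≠ 0) {P : Fin 2 → k}
    (h : eval P f = 0) : 1 ≤ multAt f P := by
  refine Nat.one_le_iff_ne_zero.2 fun h0 => homogeneousComponent_multAt_ne_zero hf P ?_
  rw [h0, homogeneousComponent_zero, eval_eq_coeff_taylorAt, h, map_zero]

theorem multAt_le_degree {f : MvPolynomial (Fin 2) k} {P : Fin 2 → k} {s : Fin 2 →₀ ℕ}
    (hs : coeff s (taylorAt f P) ≠ 0) : multAt f P ≤ s.degree := by
  refine Nat.sInf_le ?_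
  rw [Set.mem_ofPred_eq]
  intro h
  have := congrArg (coeff s) h
  rw [coeff_homogeneousComponent, if_pos rfl, coeff_zero] at this
  exact hs this

/-- The equation of the tangent cone of `f` at `P` on the exceptional line, in the chart around
`d`. -/
def tangentPoly (f : MvPolynomial (Fin 2) k) (P : Fin 2 → k) (d : OnePoint k) : Polynomial k :=
  dehomogenize (excCoord d) (homogeneousComponent (multAt f P) (taylorAt f P))

theorem totalTransform_eq (f : MvPolynomial (Fin 2) k) (P : Fin 2 → k) (d : OnePoint k) :
    totalTransform f P d = aeval (chartMap d) (taylorAt f P) := by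
  have : (aeval (chartMap d)).comp
      (aeval (fun i => X i + C (P i)) : MvPolynomial (Fin 2) k →ₐ[k] MvPolynomial (Fin 2) k)
      = aeval (fun i => chartMap d i + C (P i)) := by
    refine MvPolynomial.algHom_ext fun i => ?_
    simp [← algebraMap_eq]
  exact (DFunLike.congr_fun this f).symm

/-- The lowest form pulls back to `e ^ m` times its dehomogenization; terms of higher degree give a
further factor `e`. -/
theorem exists_totalTransform_eq (f : MvPolynomial (Fin 2) k) (P : Fin 2 → k) (d : OnePoint k) :
    ∃ h, totalTransform f P d = X (excCoord d) ^ multAt f P *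
      (Polynomial.aeval (X (excCoord d + 1)) (tangentPoly f P d) + X (excCoord d) * h) := by
  set e := excCoord d
  set m := multAt f P
  set T := taylorAt f P with hT
  set v : Fin 2 → MvPolynomial (Fin 2) k := fun i => if i = e then 1 else X i
  have hψ : chartMap d = fun i => X e * v i := funext fun i => chartMap_apply d i
  have hdvd : X e ^ (m + 1) ∣ aeval (fun i => X e * v i) (T - homogeneousComponent m T) := by
    refine pow_dvd_aeval_mul _ _ fun s hs => ?_
    rw [mem_support_iff, coeff_sub, coeff_homogeneousComponent] at hs
    split_ifs at hs with h
    · simp at hs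
    · rw [sub_zero] at hs
      exact lt_of_le_of_ne (multAt_le_degree hs) (Ne.symm h)
  obtain ⟨h, hh⟩ := hdvd
  refine ⟨h, ?_⟩
  have hz : Polynomial.aeval (X (e + 1) : MvPolynomial (Fin 2) k) (tangentPoly f P d) =
      aeval v (homogeneousComponent m T) := by
    have : (Polynomial.aeval (X (e + 1) : MvPolynomial (Fin 2) k)).comp (dehomogenize e) =
        (aeval v : MvPolynomial (Fin 2) k →ₐ[k] MvPolynomial (Fin 2) k) := by
      refine MvPolynomial.algHom_ext fun i => ?_
      rcases fin_two_eq_or e i with rfl | rfl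
      · simp [dehomogenize, v]
      · simp [dehomogenize, v]
    exact DFunLike.congr_fun this _
  rw [totalTransform_eq, hψ, ← hT, hz, mul_add,
    ← aeval_mul_of_isHomogeneous _ _ (homogeneousComponent_isHomogeneous m T)]
  rw [map_sub, sub_eq_iff_eq_add] at hh
  rw [hh]
  ring

theorem exists_strictTransform_eq (f : MvPolynomial (Fin 2) k) (P : Fin 2 → k) (d : OnePoint k) :
    ∃ h, strictTransform f P d =
      Polynomial.aeval (X (excCoord d + 1)) (tangentPoly f P d) + X (excCoord d) * h := by
  obtain ⟨h, hh⟩ := exists_totalTransform_eq f P d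
  refine ⟨h, ?_⟩
  rw [strictTransform, hh, X_pow_eq_monomial, divMonomial_monomial_mul]

theorem totalTransform_eq_mul (f : MvPolynomial (Fin 2) k) (P : Fin 2 → k) (d : OnePoint k) :
    totalTransform f P d = X (excCoord d) ^ multAt f P * strictTransform f P d := by
  obtain ⟨h, hh⟩ := exists_totalTransform_eq f P d
  rw [strictTransform, hh, X_pow_eq_monomial, divMonomial_monomial_mul]

theorem restrictLine_strictTransform (f : MvPolynomial (Fin 2) k) (P : Fin 2 → k)
    (d : OnePoint k) :
    restrictLine (excCoord d) (strictTransform f P d) = tangentPoly f P d := by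
  obtain ⟨h, hh⟩ := exists_strictTransform_eq f P d
  rw [hh, map_add, map_mul, restrictLine_X_self, restrictLine_aeval, zero_mul, add_zero]

theorem tangentPoly_ne_zero {f : MvPolynomial (Fin 2) k} (hf : f ≠ 0) (P : Fin 2 → k)
    (d : OnePoint k) : tangentPoly f P d ≠ 0 :=
  dehomogenize_ne_zero (homogeneousComponent_isHomogeneous _ _)
    (homogeneousComponent_multAt_ne_zero hf P)

theorem natDegree_tangentPoly_le (f : MvPolynomial (Fin 2) k) (P : Fin 2 → k)
    (d : OnePoint k) : (tangentPoly f P d).natDegree ≤ multAt f P :=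
  natDegree_dehomogenize_le (homogeneousComponent_isHomogeneous _ _)

theorem strictTransform_ne_zero {f : MvPolynomial (Fin 2) k} (hf : f ≠ 0) (P : Fin 2 → k)
    (d : OnePoint k) : strictTransform f P d ≠ 0 := by
  intro h
  refine tangentPoly_ne_zero hf P d ?_
  rw [← restrictLine_strictTransform, h, map_zero]

-- Besides `∞`, these points are roots of the nonzero tangent polynomial, which is the same for
-- every finite `d`.
open scoped Classical in
theorem firstNearPoints_finite {f : MvPolynomial (Fin 2) k} (hf : f ≠ 0) (P : Fin 2 → k) :
    (firstNearPoints f P).Finite := by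
  refine (((tangentPoly f P ((0 : k) : OnePoint k)).roots.toFinset.finite_toSet.image
    (fun c : k => (c : OnePoint k))).insert OnePoint.infty).subset ?_
  rintro (_ | c) hd
  · exact Or.inl rfl
  · refine Or.inr ⟨c, ?_, rfl⟩
    have h : eval (chartPoint (c : OnePoint k)) (strictTransform f P (c : OnePoint k)) = 0 := hd
    rw [eval_chartPoint, restrictLine_strictTransform] at h
    simp only [Finset.mem_coe, Multiset.mem_toFinset]
    exact (Polynomial.mem_roots (tangentPoly_ne_zero hf P _)).2 h

theorem firstNearPoints_eq_empty {f : MvPolynomial (Fin 2) k} {P : Fin 2 → k}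
    (h : eval P f ≠ 0) : firstNearPoints f P = ∅ := by
  refine Set.eq_empty_of_forall_notMem fun d hd => ?_
  have hd' : eval (chartPoint d) (strictTransform f P d) = 0 := hd
  have h1 := totalTransform_eq_mul f P d
  rw [multAt_eq_zero h, pow_zero, one_mul] at h1
  have h2 : (aeval (chartPoint d)).comp
      (aeval (fun i => chartMap d i + C (P i)) :
        MvPolynomial (Fin 2) k →ₐ[k] MvPolynomial (Fin 2) k) = aeval P := by
    refine MvPolynomial.algHom_ext fun i => ?_
    rw [AlgHom.comp_apply, aeval_X, chartMap_apply]
    simp only [map_add, map_mul, aeval_X, chartPoint_excCoord, zero_mul, zero_add]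
    simp
  have h3 := DFunLike.congr_fun h2 f
  rw [AlgHom.comp_apply, aeval_eq_eval, aeval_eq_eval] at h3
  refine h ?_
  rw [← hd', ← h1]
  exact h3.symm

/-- The colengths of `(f, g) + 𝔪 ^ N`, where `𝔪` is the maximal ideal of `P`, are at most `D`. -/
def ColengthLE (f g : MvPolynomial (Fin 2) k) (P : Fin 2 → k) (D : ℕ) : Prop :=
  ∀ N : ℕ, Module.length k (MvPolynomial (Fin 2) k ⧸
    (Ideal.span {f, g} ⊔ RingHom.ker (eval P) ^ N).restrictScalars k) ≤ D

/-! ### Drop of the colength bound -/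

theorem ColengthLE.symm {f g : MvPolynomial (Fin 2) k} {P : Fin 2 → k} {D : ℕ}
    (h : ColengthLE f g P D) : ColengthLE g f P D := by
  intro N
  rw [Set.pair_comm]
  exact h N

theorem ColengthLE.blowup_of_le {f g : MvPolynomial (Fin 2) k} {P : Fin 2 → k} {D : ℕ}
    (h : ColengthLE f g P D) (hf : f ≠ 0) (hfP : eval P f = 0)
    (hfg : multAt f P ≤ multAt g P) {d : OnePoint k} (hd : d ∈ firstNearPoints f P) :
    0 < D ∧ ColengthLE (strictTransform f P d) (strictTransform g P d) (chartPoint d) (D - 1) := by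
  suffices H : ∀ N : ℕ, Module.length k (MvPolynomial (Fin 2) k ⧸
      (Ideal.span {strictTransform f P d, strictTransform g P d} ⊔
        RingHom.ker (eval (chartPoint d)) ^ N).restrictScalars k) + 1 ≤ D by
    have hD : 0 < D := by
      have := le_add_self.trans (H 0)
      exact_mod_cast this
    refine ⟨hD, fun N => ?_⟩
    have h1 := H N
    obtain ⟨D, rfl⟩ := Nat.exists_eq_add_of_lt hD
    rw [zero_add, Nat.cast_add, Nat.cast_one] at h1
    rw [zero_add, Nat.add_sub_cancel]
    exact (ENat.add_le_add_iff_right ENat.one_ne_top).1 h1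
  intro N
  set e := excCoord d with he
  let φ : MvPolynomial (Fin 2) k →ₐ[k] MvPolynomial (Fin 2) k :=
    aeval (fun i => chartMap d i + C (P i))
  have hφ : ∀ i, φ (X i - C (P i)) = chartMap d i := by
    intro i
    simp [φ, ← algebraMap_eq]
  refine (length_quotient_blowup_add_one_le (φ := φ) (χ := restrictLine e) (x := X e)
    (z := X (e + 1)) ⟨X e - C (P e), ?_⟩ ⟨X (e + 1) - C (P (e + 1)), ?_⟩
    (X_dvd_sub_restrictLine e) (restrictLine_X_self e) (X_prime)
    (f' := strictTransform f P d) (g' := strictTransform g P d) (m := multAt f P)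
    (n := multAt g P) (N := N) ?_ ?_ (one_le_multAt hf hfP) hfg (aeval (chartPoint d)) ?_ ?_
    ?_ ?_ ?_ (M := RingHom.ker (eval P)) ?_ (totalTransform_eq_mul f P d)
    (totalTransform_eq_mul g P d)).trans (h _)
  · exact (hφ e).trans (by rw [chartMap_apply]; simp [he])
  · exact (hφ (e + 1)).trans (by rw [chartMap_apply]; simp [he])
  · rw [restrictLine_strictTransform]
    exact tangentPoly_ne_zero hf P d
  · rw [restrictLine_strictTransform]
    exact natDegree_tangentPoly_le f P d
  · simp [he, chartPoint_excCoord]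
  · rw [aeval_eq_eval]
    exact hd
  · exact Ideal.mem_sup_left (Ideal.subset_span (by simp))
  · exact Ideal.mem_sup_left (Ideal.subset_span (by simp))
  · refine Ideal.mem_sup_right (Ideal.pow_mem_pow ?_ N)
    simp [RingHom.mem_ker, he, chartPoint_excCoord]
  -- The blowup contracts the exceptional line to `P`, so pullbacks of functions vanishing at `P`
  -- are divisible by its equation.
  · intro a ha
    have h1 : (restrictLine e).comp φ = (Algebra.ofId k (Polynomial k)).comp (aeval P) := by
      refine MvPolynomial.algHom_ext fun i => ?_
      rw [AlgHom.comp_apply, aeval_X, chartMap_apply, ← he]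
      simp only [map_add, map_mul, restrictLine_X_self, zero_mul, zero_add]
      simp [restrictLine, Algebra.ofId_apply]
    have h2 := DFunLike.congr_fun h1 a
    rw [AlgHom.comp_apply, AlgHom.comp_apply, aeval_eq_eval] at h2
    have h3 := X_dvd_sub_restrictLine e (φ a)
    have h4 : eval P a = 0 := ha
    rw [h2] at h3
    simpa [h4] using h3

theorem ColengthLE.blowup {f g : MvPolynomial (Fin 2) k} {P : Fin 2 → k} {D : ℕ}
    (h : ColengthLE f g P D) (hf : f ≠ 0) (hg : g ≠ 0) (hfP : eval P f = 0) (hgP : eval P g = 0)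
    {d : OnePoint k} (hdf : d ∈ firstNearPoints f P) (hdg : d ∈ firstNearPoints g P) :
    0 < D ∧ ColengthLE (strictTransform f P d) (strictTransform g P d) (chartPoint d) (D - 1) := by
  rcases le_total (multAt f P) (multAt g P) with hle | hle
  · exact h.blowup_of_le hf hfP hle hdf
  · exact (h.symm.blowup_of_le hg hgP hle hdg).imp_right ColengthLE.symm

/-! ### Common infinitely near points and termination -/

theorem IsNearPath.take {l : List (OnePoint k)} :
    ∀ {f : MvPolynomial (Fin 2) k} {P : Fin 2 → k}, IsNearPath f P l →
      ∀ r : ℕ, IsNearPath f P (l.take r) := by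
  induction l with
  | nil => intro f P _ r; simp [IsNearPath]
  | cons d l ih =>
    intro f P h r
    cases r with
    | zero => simp [IsNearPath]
    | succ r => exact ⟨h.1, ih h.2 r⟩

theorem nearPoints_inter_eq_empty_of_le {f g : MvPolynomial (Fin 2) k} {P : Fin 2 → k} {r s : ℕ}
    (hrs : r ≤ s) (h : nearPoints f P r ∩ nearPoints g P r = ∅) :
    nearPoints f P s ∩ nearPoints g P s = ∅ := by
  refine Set.eq_empty_of_forall_notMem fun l hl => ?_
  refine Set.eq_empty_iff_forall_notMem.1 h (l.take r) ⟨⟨?_, hl.1.2.take r⟩, ⟨?_, hl.2.2.take r⟩⟩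
  · rw [List.length_take, hl.1.1]; omega
  · rw [List.length_take, hl.1.1]; omega

theorem ColengthLE.terminates {D : ℕ} : ∀ {f g : MvPolynomial (Fin 2) k} {P : Fin 2 → k},
    f ≠ 0 → g ≠ 0 → ColengthLE f g P D →
    (∃ (b : ℕ∞) (n : ℕ), ComputesB f g P b n) ∧
      ∃ r : ℕ, 1 ≤ r ∧ nearPoints f P r ∩ nearPoints g P r = ∅ := by
  induction D using Nat.strong_induction_on with
  | _ D ih =>
  intro f g P hf hg h
  by_cases hP : eval P f = 0 ∧ eval P g = 0
  · have hfin : (firstNearPoints f P ∩ firstNearPoints g P).Finite :=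
      (firstNearPoints_finite hf P).inter_of_left _
    have hstep : ∀ d : OnePoint k, ∃ (b : ℕ∞) (n r : ℕ),
        d ∈ firstNearPoints f P ∩ firstNearPoints g P →
        ComputesB (strictTransform f P d) (strictTransform g P d) (chartPoint d) b n ∧
        nearPoints (strictTransform f P d) (chartPoint d) r ∩
          nearPoints (strictTransform g P d) (chartPoint d) r = ∅ := by
      intro d
      by_cases hd : d ∈ firstNearPoints f P ∩ firstNearPoints g P
      · obtain ⟨hD, h'⟩ := h.blowup hf hg hP.1 hP.2 hd.1 hd.2
        obtain ⟨⟨b, n, hb⟩, r, -, hr⟩ := ih (D - 1) (by omega) (strictTransform_ne_zero hf P d)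
          (strictTransform_ne_zero hg P d) h'
        exact ⟨b, n, r, fun _ => ⟨hb, hr⟩⟩
      -- Junk values away from the common points, so that `choose` yields total functions.
      · exact ⟨0, 0, 0, fun h => absurd h hd⟩
    choose b n r hbr using hstep
    constructor
    · by_cases hs : ShareComponentAt f g P
      -- A shared component stops the computation at once, so the induction need not track
      -- components of strict transforms.
      · exact ⟨_, _, .share hs⟩
      · exact ⟨_, _, .blowup hs hP.1 hP.2 hfin.toFinset hfin.coe_toFinset b n
          fun d hd => (hbr d (hfin.mem_toFinset.1 hd)).1⟩
    -- The sum dominates every `r d`; the extra `1` counts the first blowup.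
    · refine ⟨(∑ d ∈ hfin.toFinset, r d) + 1, by omega, ?_⟩
      refine Set.eq_empty_of_forall_notMem ?_
      rintro (_ | ⟨d, l⟩) ⟨⟨hl, hlf⟩, ⟨-, hlg⟩⟩
      · simp at hl
      · have hd : d ∈ firstNearPoints f P ∩ firstNearPoints g P := ⟨hlf.1, hlg.1⟩
        have hle : r d ≤ ∑ d ∈ hfin.toFinset, r d :=
          Finset.single_le_sum (fun _ _ => Nat.zero_le _) (hfin.mem_toFinset.2 hd)
        refine Set.eq_empty_iff_forall_notMem.1
          (nearPoints_inter_eq_empty_of_le hle (hbr d hd).2) l ?_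
        rw [List.length_cons, Nat.add_right_cancel_iff] at hl
        exact ⟨⟨hl, hlf.2⟩, ⟨hl, hlg.2⟩⟩
  · refine ⟨⟨0, 1, .off hP⟩, 1, le_rfl, Set.eq_empty_of_forall_notMem ?_⟩
    rintro (_ | ⟨d, l⟩) ⟨⟨hl, hlf⟩, ⟨-, hlg⟩⟩
    · simp at hl
    · refine hP ⟨?_, ?_⟩ <;> by_contra h0
      · exact Set.eq_empty_iff_forall_notMem.1 (firstNearPoints_eq_empty h0) d hlf.1
      · exact Set.eq_empty_iff_forall_notMem.1 (firstNearPoints_eq_empty h0) d hlg.1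

/-! ### Existence of a colength bound -/

/-- A prime factor `π` of `f` in `p` gives `0 < (π) < p`, strict because `π ∤ g`. So `p` has height
at least `2`, the dimension of the plane. -/
theorem isMaximal_of_isRelPrime_mem {f g : MvPolynomial (Fin 2) k} (hf : f ≠ 0)
    (hfg : IsRelPrime f g) {p : Ideal (MvPolynomial (Fin 2) k)} [hp : p.IsPrime] (hfp : f ∈ p)
    (hgp : g ∈ p) : p.IsMaximal := by
  obtain ⟨π, hπp, hπ, hπf⟩ : ∃ π ∈ p, Prime π ∧ π ∣ f := by
    obtain ⟨s, hs, u, rfl⟩ := UniqueFactorizationMonoid.exists_prime_factors f hf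
    rcases hp.mem_or_mem hfp with h | h
    · obtain ⟨π, hπs, hπp⟩ := (hp.multiset_prod_mem_iff_exists_mem s).1 h
      exact ⟨π, hπp, hs π hπs, (Multiset.dvd_prod hπs).mul_right _⟩
    · exact absurd (p.eq_top_of_isUnit_mem h u.isUnit) hp.ne_top
  have hlt : Ideal.span {π} < p := by
    refine lt_of_le_of_ne ((Ideal.span_singleton_le_iff_mem p).2 hπp) ?_
    rintro rfl
    exact hπ.not_isUnit (hfg hπf (Ideal.mem_span_singleton.1 hgp))
  have hπprime : (Ideal.span {π}).IsPrime := (Ideal.span_singleton_prime hπ.ne_zero).2 hπ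
  have hbot : (⊥ : Ideal (MvPolynomial (Fin 2) k)) < Ideal.span {π} :=
    bot_lt_iff_ne_bot.2 (by simpa using hπ.ne_zero)
  have h1 := Ideal.height_add_one_le_of_lt_of_isPrime hbot
  have h2 := Ideal.height_add_one_le_of_lt_of_isPrime hlt
  rw [Ideal.height_bot, zero_add] at h1
  have h3 : 2 ≤ p.height := by
    refine le_trans ?_ h2
    rw [← one_add_one_eq_two]
    gcongr
  have hdim : ringKrullDim (MvPolynomial (Fin 2) k) = (2 : ℕ∞) := by
    rw [MvPolynomial.ringKrullDim_of_isNoetherianRing, ringKrullDim_eq_zero_of_field]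
    simp
  obtain ⟨q, hq, hpq⟩ := p.exists_le_maximal hp.ne_top
  rcases hpq.eq_or_lt with rfl | hpq
  · exact hq
  · exfalso
    have := hq.isPrime
    have h4 := Ideal.height_add_one_le_of_lt_of_isPrime hpq
    have h5 := Ideal.height_le_ringKrullDim_of_ne_top hq.ne_top
    rw [hdim, WithBot.coe_le_coe] at h5
    have h6 : (2 : ℕ∞) + 1 ≤ 2 := by
      refine le_trans ?_ (h4.trans h5)
      gcongr
    exact absurd h6 (by decide)

theorem finite_quotient_of_isRelPrime {f g : MvPolynomial (Fin 2) k} (hf : f ≠ 0)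
    (hfg : IsRelPrime f g) :
    Module.Finite k (MvPolynomial (Fin 2) k ⧸ Ideal.span {f, g}) := by
  rw [Module.finite_iff_krullDimLE_zero,
    Ideal.krullDimLE_zero_quotient_iff_forall_minimalPrimes_isMaximal]
  intro p hp
  have := hp.1.1
  exact isMaximal_of_isRelPrime_mem hf hfg (hp.1.2 (Ideal.subset_span (by simp)))
    (hp.1.2 (Ideal.subset_span (by simp)))

/-- Write `f = c f₁`, `g = c g₁` with `f₁`, `g₁` coprime. No factor of `c` vanishes at `P`, so `c`
is a unit modulo `𝔪 ^ N`, and the finite colength of `(f₁, g₁)` is a bound for every `N`. -/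
theorem exists_colengthLE {f g : MvPolynomial (Fin 2) k} {P : Fin 2 → k} (hf : f ≠ 0)
    (hfg : ¬ ShareComponentAt f g P) : ∃ D, ColengthLE f g P D := by
  obtain ⟨f₁, g₁, c, hrel, rfl, rfl⟩ := UniqueFactorizationMonoid.exists_reduced_factors f hf g
  have hc : c ≠ 0 := left_ne_zero_of_mul hf
  have hcP : eval P c ≠ 0 := by
    intro h0
    obtain ⟨s, hs, u, rfl⟩ := UniqueFactorizationMonoid.exists_prime_factors c hc
    have hu : eval P (u : MvPolynomial (Fin 2) k) ≠ 0 := (u.isUnit.map (eval P)).ne_zero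
    rw [map_mul, mul_eq_zero, or_iff_left hu, ← RingHom.mem_ker] at h0
    obtain ⟨π, hπs, hπP⟩ :=
      ((RingHom.ker_isPrime (eval P)).multiset_prod_mem_iff_exists_mem s).1 h0
    have hd : π ∣ s.prod * u := (Multiset.dvd_prod hπs).mul_right _
    exact hfg ⟨π, (hs π hπs).irreducible, hd.mul_right _, hd.mul_right _, hπP⟩
  have hfin := finite_quotient_of_isRelPrime (right_ne_zero_of_mul hf) hrel
  have hne : Module.length k (MvPolynomial (Fin 2) k ⧸ Ideal.span {f₁, g₁}) ≠ ⊤ :=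
    Module.length_ne_top
  obtain ⟨D, hD⟩ := ENat.ne_top_iff_exists.1 hne
  refine ⟨D, fun N => ?_⟩
  rw [hD, ← (Submodule.Quotient.restrictScalarsEquiv k (Ideal.span {f₁, g₁})).length_eq]
  set I := Ideal.span {c * f₁, c * g₁} ⊔ RingHom.ker (eval P) ^ N with hI
  -- `c` is invertible modulo every power of the maximal ideal of `P`
  have hcop : IsCoprime (Ideal.span {c}) (RingHom.ker (eval P) ^ N) := by
    refine IsCoprime.pow_right (Ideal.isCoprime_iff_exists.2 ⟨C (eval P c)⁻¹ * c, ?_,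
      1 - C (eval P c)⁻¹ * c, ?_, by ring⟩)
    · exact Ideal.mem_span_singleton'.2 ⟨_, rfl⟩
    · simp [RingHom.mem_ker, hcP]
  obtain ⟨y, hy, w, hw, hyw⟩ := Ideal.isCoprime_iff_exists.1 hcop
  obtain ⟨a, rfl⟩ := Ideal.mem_span_singleton'.1 hy
  have hmem : ∀ h, c * h ∈ I → h ∈ I := by
    intro h hh
    have : h = a * (c * h) + w * h := by linear_combination (-h) * hyw
    rw [this]
    exact I.add_mem (I.mul_mem_left _ hh) (I.mul_mem_right _ (Ideal.mem_sup_right hw))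
  have hle : (Ideal.span {f₁, g₁}).restrictScalars k ≤ I.restrictScalars k := by
    refine (Ideal.span_le.2 ?_ : Ideal.span {f₁, g₁} ≤ I)
    rintro h (rfl | rfl)
    · exact hmem _ (Ideal.mem_sup_left (Ideal.subset_span (by simp)))
    · exact hmem _ (Ideal.mem_sup_left (Ideal.subset_span (by simp)))
  exact Module.length_le_of_surjective _ (Submodule.factor_surjective hle)

end PlaneBlowup

end

theorem lemma3p2 {k : Type*} [Field k] [IsAlgClosed k] [CharZero k]
    (f g : MvPolynomial (Fin 2) k) (P : Fin 2 → k)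
    (hf : 0 < f.totalDegree) (hg : 0 < g.totalDegree)
    (hfg : ¬ PlaneBlowup.ShareComponentAt f g P) :
    (∃ (b : ℕ∞) (n : ℕ), PlaneBlowup.ComputesB f g P b n) ∧
      ∃ r : ℕ, 1 ≤ r ∧ PlaneBlowup.nearPoints f P r ∩ PlaneBlowup.nearPoints g P r = ∅ := by
  have hf0 : f ≠ 0 := by
    rintro rfl
    simp at hf
  have hg0 : g ≠ 0 := by
    rintro rfl
    simp at hg
  obtain ⟨D, hD⟩ := PlaneBlowup.exists_colengthLE hf0 hfg
  exact hD.terminates hf0 hg0
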